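/- Let $k$ be a field. A *graded algebra* means a connected $\mathbb{N}$-graded $k$-algebra: a unital associative $k$-algebra $A=\bigoplus_{n\ge 0}A_n$ with $A_m A_n\subseteq A_{m+n}$ and $A_0=k$ that is generated by finitely many homogeneous elements. A graded algebra is *graded left coherent* if every finitely generated graded left ideal is finitely presented as a left module. Let $A$ and $B$ be graded algebras such that $B$ is graded left coherent, and suppose that $A$ is a graded right-free extension of $B$ by the ideal $I$; that is, there is a surjective morphism of graded $k$-algebras $\pi\colon A\to B$ whose kernel $I=\ker\pi$ is free as a right $A$-module. For a left ideal $J$ of $A$, let $IJ$ be the additive span of the products $xy$ with $x\in I$, $y\in J$; the quotient $(I\cap J)/(IJ)$ is a left $B$-module via $\pi(a)\cdot(y+IJ)=ay+IJ$ for $a\in A$, $y\in I\cap J$. Then: 1. For every finitely generated graded left ideal $J$ of $A$, the left $B$-module $(I\cap J)/(IJ)$ is finitely generated. 2. $A$ is graded left coherent if and only if for every finitely generated graded left ideal $J$ of $A$ the left $B$-module $(I\cap J)/(IJ)$ is finitely presented. -/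

import Mathlib

/-- `A = ⨁ₙ 𝒜 n` is a connected `ℕ`-graded `k`-algebra: the degree zero part is a copy of `k`
(so `A ≠ 0`), and `A` is generated as a `k`-algebra by finitely many homogeneous elements. -/
class IsConnectedGradedAlgebra {k A : Type*} [Field k] [Ring A] [Algebra k A]
    (𝒜 : ℕ → Submodule k A) [GradedAlgebra 𝒜] : Prop where
  nontrivial : Nontrivial A
  degree_zero : 𝒜 0 = LinearMap.range (Algebra.linearMap k A)
  generated : ∃ s : Finset A, (∀ x ∈ s, SetLike.IsHomogeneousElem 𝒜 x) ∧
    Algebra.adjoin k (s : Set A) = ⊤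

/-- A graded algebra is graded left coherent if every finitely generated graded left ideal is
finitely presented as a left module. (In Mathlib, `Ideal A` is the type of left ideals of `A`.) -/
def IsGradedLeftCoherent {k A : Type*} [Field k] [Ring A] [Algebra k A]
    (𝒜 : ℕ → Submodule k A) [GradedAlgebra 𝒜] : Prop :=
  ∀ J : Ideal A, J.IsHomogeneous 𝒜 → J.FG → Module.FinitePresentation A J

/-- The kernel of a ring homomorphism, as a right ideal, that is, as a submodule of the right
module `A` (right `A`-modules are `Aᵐᵒᵖ`-modules). -/
def rightKer {A B : Type*} [Ring A] [Ring B] (f : A →+* B) : Submodule Aᵐᵒᵖ A where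
  carrier := {x | f x = 0}
  zero_mem' := map_zero f
  add_mem' {x y} hx hy := by
    simp only [Set.mem_ofPred_eq] at hx hy ⊢
    rw [map_add, hx, hy, add_zero]
  smul_mem' c x hx := by
    simp only [Set.mem_ofPred_eq] at hx ⊢
    rw [← MulOpposite.op_unop c, op_smul_eq_mul, map_mul, hx, zero_mul]

/-- The datum of a surjective graded algebra morphism `π : A → B` whose kernel is a free right
`A`-module, exhibiting `A` as a graded right-free extension of `B` (by the ideal `ker π`). -/
structure GradedRightFreeExtension {k A B : Type*} [Field k] [Ring A] [Algebra k A]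
    [Ring B] [Algebra k B] (𝒜 : ℕ → Submodule k A) [GradedAlgebra 𝒜]
    (ℬ : ℕ → Submodule k B) [GradedAlgebra ℬ] where
  π : A →ₐ[k] B
  map_mem : ∀ (n : ℕ) (a : A), a ∈ 𝒜 n → π a ∈ ℬ n
  surjective : Function.Surjective π
  free : Module.Free Aᵐᵒᵖ (rightKer (π : A →+* B))

namespace GradedRightFreeExtension

variable {k A B : Type*} [Field k] [Ring A] [Algebra k A] [Ring B] [Algebra k B]
  {𝒜 : ℕ → Submodule k A} [GradedAlgebra 𝒜] {ℬ : ℕ → Submodule k B} [GradedAlgebra ℬ]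

/-- The two-sided ideal `I = ker π` by which `A` is an extension of `B`. -/
def I (E : GradedRightFreeExtension 𝒜 ℬ) : Ideal A := RingHom.ker E.π

theorem mem_I (E : GradedRightFreeExtension 𝒜 ℬ) {a : A} : a ∈ E.I ↔ E.π a = 0 := Iff.rfl

instance (E : GradedRightFreeExtension 𝒜 ℬ) : E.I.IsTwoSided :=
  inferInstanceAs (RingHom.ker E.π).IsTwoSided

/-- The abelian group `(I ∩ J) / (I J)`, where `I J` is the additive span of the products
`x * y` with `x ∈ I` and `y ∈ J`. Note that `I J ⊆ I ∩ J`, as `I` is two-sided. -/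
def InterQuot (E : GradedRightFreeExtension 𝒜 ℬ) (J : Ideal A) : Type _ :=
  ↥(E.I ⊓ J) ⧸ (E.I * J).submoduleOf (E.I ⊓ J)

noncomputable instance (E : GradedRightFreeExtension 𝒜 ℬ) (J : Ideal A) :
    AddCommGroup (E.InterQuot J) :=
  inferInstanceAs (AddCommGroup (↥(E.I ⊓ J) ⧸ (E.I * J).submoduleOf (E.I ⊓ J)))

/-- The quotient map `y ↦ y + I J` from `I ∩ J` to `(I ∩ J) / (I J)`. -/
def InterQuot.mk (E : GradedRightFreeExtension 𝒜 ℬ) (J : Ideal A) :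
    ↥(E.I ⊓ J) →+ E.InterQuot J :=
  ((E.I * J).submoduleOf (E.I ⊓ J)).mkQ.toAddMonoidHom

/-- `b : B` acts on `(I ∩ J) / (I J)` as any `a : A` with `π a = b` does. -/
noncomputable instance (E : GradedRightFreeExtension 𝒜 ℬ) (J : Ideal A) :
    SMul B (E.InterQuot J) where
  smul b := fun (m : ↥(E.I ⊓ J) ⧸ (E.I * J).submoduleOf (E.I ⊓ J)) =>
    Function.surjInv E.surjective b • m

theorem InterQuot.smul_mk (E : GradedRightFreeExtension 𝒜 ℬ) (J : Ideal A) (a : A)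
    (y : ↥(E.I ⊓ J)) : E.π a • InterQuot.mk E J y = InterQuot.mk E J (a • y) := by
  have h : Function.surjInv E.surjective (E.π a) - a ∈ E.I := by
    rw [mem_I, map_sub, Function.surjInv_eq E.surjective, sub_self]
  refine (Submodule.Quotient.eq ((E.I * J).submoduleOf (E.I ⊓ J))).2 ?_
  rw [← sub_smul]
  exact Ideal.mul_mem_mul h y.2.2

/-- The left `B`-module structure on `(I ∩ J) / (I J)`, given by
`π a • (y + I J) = a * y + I J`. -/
noncomputable instance (E : GradedRightFreeExtension 𝒜 ℬ) (J : Ideal A) :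
    Module B (E.InterQuot J) :=
  letI : Module A (E.InterQuot J) :=
    inferInstanceAs (Module A (↥(E.I ⊓ J) ⧸ (E.I * J).submoduleOf (E.I ⊓ J)))
  Function.Surjective.moduleLeft (E.π : A →+* B) E.surjective fun a m => by
    obtain ⟨y, rfl⟩ := Submodule.mkQ_surjective ((E.I * J).submoduleOf (E.I ⊓ J)) m
    exact InterQuot.smul_mk E J a y

end GradedRightFreeExtension

/-! Let homogeneous `xᵢ` generate `J`, let `S` be the module of relations among the `xᵢ` over `A`,
and let `L` be that among the `π xᵢ` over `B`. Lifting `b ∈ L` to `a` and sending it to `∑ aᵢ xᵢ`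
gives a surjection `L → (I ∩ J)/(IJ)` with kernel `π(S)` (`exists_relations_to_interQuot`).
Coherence of `B` makes `L` finitely generated, which is the first claim. It even makes `L` finitely
presented (`IsGradedLeftCoherent.finitePresentation`), so `(I ∩ J)/(IJ)` is finitely presented iff
`π(S)` is finitely generated.

On the other side, `J` is finitely presented iff `S` is finitely generated. Right-freeness of `I`
makes every relation with coefficients in `I` lie in `IS` (`mem_I_smul_ker`). Since `I` lives in
positive degrees, a graded Nakayama argument (`ker_le_of_piMap`) shows that `S` is finitely
generated iff `π(S)` is. The second claim thus holds ideal by ideal. -/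

open DirectSum

/-! ### Graded free modules with shifts -/

section ShiftedGrading

variable {k A : Type*} [Field k] [Ring A] [Algebra k A] (𝒜 : ℕ → Submodule k A)
  [GradedAlgebra 𝒜] {ι : Type*} (d : ι → ℕ)

/-- The projection of `⨁ᵢ A(-dᵢ)` onto its component of degree `m`. -/
def shiftedProj (m : ℕ) : (ι → A) →+ (ι → A) where
  -- The test matters: for `m < d i`, truncated subtraction would pick out the component of degree
  -- `0`.
  toFun a i := if d i ≤ m then (decompose 𝒜 (a i) (m - d i) : A) else 0
  map_zero' := by ext i; simp
  map_add' a b := by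
    ext i
    by_cases h : d i ≤ m <;> simp [h]

theorem shiftedProj_apply (m : ℕ) (a : ι → A) (i : ι) :
    shiftedProj 𝒜 d m a i = if d i ≤ m then (decompose 𝒜 (a i) (m - d i) : A) else 0 := rfl

/-- Homogeneous submodules of the graded free module `⨁ᵢ A(-dᵢ)`. -/
def IsShiftedHomogeneous (L : Submodule A (ι → A)) : Prop :=
  ∀ m, ∀ a ∈ L, shiftedProj 𝒜 d m a ∈ L

theorem shiftedProj_smul_of_mem {e : ℕ} {b : A} (hb : b ∈ 𝒜 e) (c : ι → A) (m : ℕ) :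
    shiftedProj 𝒜 d m (b • c) = if e ≤ m then b • shiftedProj 𝒜 d (m - e) c else 0 := by
  ext i
  rw [shiftedProj_apply, Pi.smul_apply, smul_eq_mul, coe_decompose_mul_of_left_mem 𝒜 _ hb]
  by_cases h1 : e ≤ m
  · rw [if_pos h1, Pi.smul_apply, shiftedProj_apply, smul_eq_mul]
    by_cases h2 : d i ≤ m
    · by_cases h3 : e ≤ m - d i
      · rw [if_pos h2, if_pos h3, if_pos (by omega), Nat.sub_right_comm]
      · rw [if_pos h2, if_neg h3, if_neg (by omega), mul_zero]
    · rw [if_neg h2, if_neg (by omega), mul_zero]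
  · rw [if_neg h1, if_neg (by omega : ¬ e ≤ m - d i), ite_self, Pi.zero_apply]

theorem shiftedProj_smul_mem {T : Submodule A (ι → A)} {b : A} {c : ι → A} {m : ℕ}
    (h : ∀ e ≤ m, (decompose 𝒜 b e : A) • shiftedProj 𝒜 d (m - e) c ∈ T) :
    shiftedProj 𝒜 d m (b • c) ∈ T := by
  classical
  rw [← sum_support_decompose 𝒜 b, Finset.sum_smul, map_sum]
  refine Submodule.sum_mem _ fun e _ => ?_
  rw [shiftedProj_smul_of_mem 𝒜 d (SetLike.coe_mem _)]
  split_ifs with he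
  · exact h e he
  · exact T.zero_mem

theorem shiftedProj_shiftedProj (m n : ℕ) (a : ι → A) :
    shiftedProj 𝒜 d m (shiftedProj 𝒜 d n a) = if m = n then shiftedProj 𝒜 d n a else 0 := by
  ext i
  rw [shiftedProj_apply]
  by_cases h1 : d i ≤ n
  · have hn : shiftedProj 𝒜 d n a i = (decompose 𝒜 (a i) (n - d i) : A) := by
      rw [shiftedProj_apply, if_pos h1]
    by_cases h : m = n
    · subst h
      rw [if_pos h1, if_pos rfl, hn, decompose_of_mem_same 𝒜 (SetLike.coe_mem _)]
    · rw [if_neg h, Pi.zero_apply, hn]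
      split_ifs with h2
      · exact decompose_of_mem_ne 𝒜 (SetLike.coe_mem _) (by omega)
      · rfl
  · have hn : shiftedProj 𝒜 d n a i = 0 := by rw [shiftedProj_apply, if_neg h1]
    split_ifs <;> simp [hn]

theorem exists_sum_shiftedProj [Finite ι] (a : ι → A) :
    ∃ N, ∑ m ∈ Finset.range N, shiftedProj 𝒜 d m a = a ∧ ∀ m ≥ N, shiftedProj 𝒜 d m a = 0 := by
  classical
  have := Fintype.ofFinite ι
  have hbound (x : A) : ∃ K, ∀ n ≥ K, (decompose 𝒜 x n : A) = 0 := by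
    refine ⟨(decompose 𝒜 x).support.sup id + 1, fun n hn => ?_⟩
    by_contra h
    have hmem : n ∈ (decompose 𝒜 x).support := by
      rw [DFinsupp.mem_support_iff]
      exact fun h0 => h (by rw [h0]; rfl)
    have := Finset.le_sup (f := id) hmem
    simp only [id] at this
    omega
  choose K hK using fun i => hbound (a i)
  have hle (i : ι) : d i + K i ≤ Finset.univ.sup fun i => d i + K i :=
    Finset.le_sup (f := fun i => d i + K i) (Finset.mem_univ i)
  refine ⟨Finset.univ.sup fun i => d i + K i, ?_, fun m hm => ?_⟩
  · ext i
    -- The terms with `m < d i` vanish; the other `M ≥ K i` terms run through all nonzero components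
    -- of `a i`.
    obtain ⟨M, hM⟩ := Nat.exists_eq_add_of_le ((Nat.le_add_right _ _).trans (hle i))
    have hKM : K i ≤ M := by have := hle i; omega
    rw [Finset.sum_apply, hM, Finset.sum_range_add, Finset.sum_eq_zero, zero_add]
    · conv_rhs => rw [← sum_support_decompose 𝒜 (a i)]
      have hsub : (decompose 𝒜 (a i)).support ⊆ Finset.range M := by
        intro n hn
        by_contra h
        rw [DFinsupp.mem_support_iff] at hn
        exact hn (Subtype.ext (hK i n (by rw [Finset.mem_range] at h; omega)))
      rw [Finset.sum_subset hsub]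
      · refine Finset.sum_congr rfl fun n _ => ?_
        rw [shiftedProj_apply, if_pos (Nat.le_add_right _ _), Nat.add_sub_cancel_left]
      · intro n _ hn
        rw [DFinsupp.notMem_support_iff] at hn
        rw [hn]; rfl
    · intro m hm
      rw [shiftedProj_apply, if_neg (by rw [Finset.mem_range] at hm; omega)]
  · ext i
    rw [shiftedProj_apply]
    split_ifs
    · exact hK i _ (by have := hle i; omega)
    · rfl

theorem finite_range_shiftedProj [Finite ι] (a : ι → A) :
    (Set.range fun m => shiftedProj 𝒜 d m a).Finite := by
  obtain ⟨N, -, hN⟩ := exists_sum_shiftedProj 𝒜 d a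
  refine (((Finset.range N).finite_toSet.image fun m => shiftedProj 𝒜 d m a).insert 0).subset ?_
  rintro _ ⟨m, rfl⟩
  by_cases h : m < N
  · exact Or.inr ⟨m, by simpa using h, rfl⟩
  · exact Or.inl (hN m (by omega))

theorem mem_of_forall_shiftedProj_mem [Finite ι] {T : Submodule A (ι → A)} {a : ι → A}
    (h : ∀ m, shiftedProj 𝒜 d m a ∈ T) : a ∈ T := by
  obtain ⟨N, hN, -⟩ := exists_sum_shiftedProj 𝒜 d a
  rw [← hN]
  exact Submodule.sum_mem _ fun m _ => h m

theorem isShiftedHomogeneous_span {s : Set (ι → A)}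
    (h : ∀ x ∈ s, ∀ m, shiftedProj 𝒜 d m x ∈ Submodule.span A s) :
    IsShiftedHomogeneous 𝒜 d (Submodule.span A s) := by
  intro m a ha
  induction ha using Submodule.span_induction generalizing m with
  | mem x hx => exact h x hx m
  | zero => rw [map_zero]; exact Submodule.zero_mem _
  | add x y _ _ hx hy => rw [map_add]; exact Submodule.add_mem _ (hx m) (hy m)
  | smul b x _ hx =>
    exact shiftedProj_smul_mem 𝒜 d fun e _ => Submodule.smul_mem _ _ (hx (m - e))

/-- A finitely generated submodule of a homogeneous submodule lies in a finitely generated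
homogeneous one. -/
theorem IsShiftedHomogeneous.exists_fg_homogeneous [Finite ι] {L : Submodule A (ι → A)}
    (hL : IsShiftedHomogeneous 𝒜 d L) {t : Set (ι → A)} (ht : t.Finite) (htL : t ⊆ L) :
    ∃ T ≤ L, T.FG ∧ IsShiftedHomogeneous 𝒜 d T ∧ t ⊆ T := by
  refine ⟨Submodule.span A (⋃ a ∈ t, Set.range fun m => shiftedProj 𝒜 d m a), ?_, ?_, ?_, ?_⟩
  · rw [Submodule.span_le]
    refine Set.iUnion₂_subset fun a ha => ?_
    rintro _ ⟨m, rfl⟩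
    exact hL m a (htL ha)
  · exact Submodule.fg_span (ht.biUnion fun a _ => finite_range_shiftedProj 𝒜 d a)
  · refine isShiftedHomogeneous_span 𝒜 d fun x hx m => ?_
    obtain ⟨a, ha, n, rfl⟩ := Set.mem_iUnion₂.1 hx
    dsimp only
    rw [shiftedProj_shiftedProj]
    split_ifs
    · exact Submodule.subset_span hx
    · exact Submodule.zero_mem _
  · exact fun a ha => mem_of_forall_shiftedProj_mem 𝒜 d fun m =>
      Submodule.subset_span (Set.mem_iUnion₂.2 ⟨a, ha, m, rfl⟩)

/-! ### Coherence for submodules of graded free modules -/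

/-- Induction on the coordinates in use: projecting to one of them has a homogeneous left ideal as
image, finitely presented by coherence. The kernel is therefore finitely generated and uses one
coordinate fewer, and an extension of finitely presented modules is finitely presented. -/
theorem IsGradedLeftCoherent.finitePresentation_of_support (hA : IsGradedLeftCoherent 𝒜)
    (s : Finset ι) (L : Submodule A (ι → A)) (hL : IsShiftedHomogeneous 𝒜 d L) (hfg : L.FG)
    (hs : ∀ a ∈ L, ∀ i ∉ s, a i = 0) : Module.FinitePresentation A L := by
  classical
  induction s using Finset.induction_on generalizing L with
  | empty =>
    have : Subsingleton L := by
      rw [Submodule.subsingleton_iff_eq_bot, Submodule.eq_bot_iff]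
      exact fun a ha => funext fun i => hs a ha i (Finset.notMem_empty i)
    infer_instance
  | insert i s _ ih =>
    let p : (ι → A) →ₗ[A] A := LinearMap.proj i
    have hJ : Ideal.IsHomogeneous 𝒜 (L.map p) := by
      rintro m _ ⟨a, ha, rfl⟩
      refine ⟨shiftedProj 𝒜 d (m + d i) a, hL _ a ha, ?_⟩
      rw [LinearMap.proj_apply, shiftedProj_apply, if_pos (Nat.le_add_left _ _),
        Nat.add_sub_cancel]
      rfl
    have : Module.FinitePresentation A (L.map p) := hA _ hJ (hfg.map p)
    have : Module.Finite A L := Module.Finite.of_fg hfg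
    let l : L →ₗ[A] L.map p := p.submoduleMap L
    have hl : Function.Surjective l := p.submoduleMap_surjective L
    have hker := Module.FinitePresentation.fg_ker l hl
    have hmem (a : ι → A) : a ∈ (LinearMap.ker l).map L.subtype ↔ a ∈ L ∧ a i = 0 := by
      constructor
      · rintro ⟨b, hb, rfl⟩
        exact ⟨b.2, congrArg Subtype.val hb⟩
      · rintro ⟨ha, h0⟩
        exact ⟨⟨a, ha⟩, Subtype.ext h0, rfl⟩
    have : Module.FinitePresentation A ((LinearMap.ker l).map L.subtype) := by
      refine ih _ ?_ (hker.map _) ?_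
      · intro m a ha
        rw [hmem] at ha ⊢
        exact ⟨hL m a ha.1, by rw [shiftedProj_apply, ha.2]; simp⟩
      · intro a ha j hj
        rw [hmem] at ha
        by_cases hji : j = i
        · rw [hji, ha.2]
        · exact hs a ha.1 j (by simp [hji, hj])
    have : Module.FinitePresentation A (LinearMap.ker l) :=
      .of_equiv (M := (LinearMap.ker l).map L.subtype) (N := LinearMap.ker l)
        (Submodule.equivSubtypeMap L (LinearMap.ker l)).symm
    exact Module.finitePresentation_of_ker l hl

/-- Over a graded left coherent algebra, finitely generated homogeneous submodules of graded free
modules of finite rank are finitely presented. -/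
theorem IsGradedLeftCoherent.finitePresentation [Finite ι] (hA : IsGradedLeftCoherent 𝒜)
    (L : Submodule A (ι → A)) (hL : IsShiftedHomogeneous 𝒜 d L) (hfg : L.FG) :
    Module.FinitePresentation A L :=
  have := Fintype.ofFinite ι
  hA.finitePresentation_of_support 𝒜 d Finset.univ L hL hfg fun _ _ i hi =>
    (hi (Finset.mem_univ i)).elim

/-! ### Relations among homogeneous elements -/

theorem decompose_linearCombination [Fintype ι] {x : ι → A} (hx : ∀ i, x i ∈ 𝒜 (d i))
    (a : ι → A) (m : ℕ) : (decompose 𝒜 (Fintype.linearCombination A x a) m : A) =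
      Fintype.linearCombination A x (shiftedProj 𝒜 d m a) := by
  rw [Fintype.linearCombination_apply, Fintype.linearCombination_apply, decompose_sum,
    DirectSum.sum_apply, AddSubmonoidClass.coe_finsetSum]
  refine Finset.sum_congr rfl fun i _ => ?_
  rw [smul_eq_mul, smul_eq_mul, coe_decompose_mul_of_right_mem 𝒜 _ (hx i), shiftedProj_apply,
    ite_mul, zero_mul]

theorem isShiftedHomogeneous_ker [Fintype ι] {x : ι → A} (hx : ∀ i, x i ∈ 𝒜 (d i)) :
    IsShiftedHomogeneous 𝒜 d (LinearMap.ker (Fintype.linearCombination A x)) := by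
  intro m a ha
  rw [LinearMap.mem_ker] at ha ⊢
  rw [← decompose_linearCombination 𝒜 d hx, ha]
  simp

theorem isHomogeneous_range [Fintype ι] {x : ι → A} (hx : ∀ i, x i ∈ 𝒜 (d i)) :
    Ideal.IsHomogeneous 𝒜 (LinearMap.range (Fintype.linearCombination A x)) := by
  rintro m _ ⟨a, rfl⟩
  exact ⟨shiftedProj 𝒜 d m a, (decompose_linearCombination 𝒜 d hx a m).symm⟩

theorem Ideal.IsHomogeneous.exists_generators {J : Ideal A} (hJ : J.IsHomogeneous 𝒜)
    (hfg : J.FG) : ∃ t : Finset A, ∃ e : t → ℕ, (∀ i : t, (i : A) ∈ 𝒜 (e i)) ∧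
      LinearMap.range (Fintype.linearCombination A (Subtype.val : t → A)) = J := by
  classical
  obtain ⟨s, rfl⟩ := hfg
  let t : Finset A :=
    s.biUnion fun a => (decompose 𝒜 a).support.image fun n => (decompose 𝒜 a n : A)
  have ht (i : t) : ∃ n, (i : A) ∈ 𝒜 n := by
    obtain ⟨a, -, h⟩ := Finset.mem_biUnion.1 i.2
    obtain ⟨n, -, h⟩ := Finset.mem_image.1 h
    exact ⟨n, h ▸ SetLike.coe_mem _⟩
  choose e he using ht
  refine ⟨t, e, he, ?_⟩
  rw [Fintype.range_linearCombination, Subtype.range_coe]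
  apply le_antisymm <;> rw [Submodule.span_le]
  · intro y hy
    obtain ⟨a, ha, h⟩ := Finset.mem_biUnion.1 hy
    obtain ⟨n, -, rfl⟩ := Finset.mem_image.1 h
    exact hJ n (Submodule.subset_span ha)
  · intro a ha
    rw [SetLike.mem_coe, ← sum_support_decompose 𝒜 a]
    exact Submodule.sum_mem _ fun n hn => Submodule.subset_span
      (Finset.mem_biUnion.2 ⟨a, ha, Finset.mem_image_of_mem _ hn⟩)

theorem finitePresentation_range_iff [Fintype ι] (x : ι → A) :
    Module.FinitePresentation A (LinearMap.range (Fintype.linearCombination A x)) ↔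
      (LinearMap.ker (Fintype.linearCombination A x)).FG := by
  rw [← Module.FinitePresentation.fg_ker_iff _ (LinearMap.surjective_rangeRestrict _),
    LinearMap.ker_rangeRestrict]

end ShiftedGrading

/-! ### Comparing relations over `A` and over `B` -/

namespace GradedRightFreeExtension

variable {k A B : Type*} [Field k] [Ring A] [Algebra k A] [Ring B] [Algebra k B]
  {𝒜 : ℕ → Submodule k A} [GradedAlgebra 𝒜] {ℬ : ℕ → Submodule k B} [GradedAlgebra ℬ]

theorem decompose_π (E : GradedRightFreeExtension 𝒜 ℬ) (a : A) (m : ℕ) :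
    (decompose ℬ (E.π a) m : B) = E.π (decompose 𝒜 a m) := by
  induction a using DirectSum.Decomposition.inductionOn 𝒜 with
  | zero => simp
  | @homogeneous n a =>
    by_cases h : n = m
    · subst h
      rw [decompose_of_mem_same ℬ (E.map_mem n _ a.2), decompose_of_mem_same 𝒜 a.2]
    · rw [decompose_of_mem_ne ℬ (E.map_mem n _ a.2) h, decompose_of_mem_ne 𝒜 a.2 h, map_zero]
  | add a b ha hb => simp [ha, hb]

/-- `π` is injective on the degree zero part, a copy of `k`, because `B ≠ 0`. This is what makes the
Nakayama induction on degrees work. -/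
theorem decompose_zero_of_mem_I [IsConnectedGradedAlgebra 𝒜] [IsConnectedGradedAlgebra ℬ]
    (E : GradedRightFreeExtension 𝒜 ℬ) {a : A} (ha : a ∈ E.I) : (decompose 𝒜 a 0 : A) = 0 := by
  have : Nontrivial B := IsConnectedGradedAlgebra.nontrivial ℬ
  obtain ⟨c, hc⟩ : (decompose 𝒜 a 0 : A) ∈ LinearMap.range (Algebra.linearMap k A) :=
    (IsConnectedGradedAlgebra.degree_zero (𝒜 := 𝒜)).le (SetLike.coe_mem _)
  have hπ : E.π (decompose 𝒜 a 0 : A) = 0 := by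
    rw [← E.decompose_π, E.mem_I.1 ha]
    simp
  rw [← hc, Algebra.linearMap_apply, AlgHom.commutes] at hπ
  rw [← hc, (algebraMap k B).injective (hπ.trans (map_zero _).symm), map_zero]

instance (E : GradedRightFreeExtension 𝒜 ℬ) : RingHomSurjective (E.π : A →+* B) :=
  ⟨E.surjective⟩

variable {ι : Type*}

/-- The coordinatewise application of `π`, as a semilinear map of free modules. -/
def piMap (E : GradedRightFreeExtension 𝒜 ℬ) (ι : Type*) :
    (ι → A) →ₛₗ[(E.π : A →+* B)] (ι → B) where
  toFun a i := E.π (a i)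
  map_add' a b := by ext i; simp
  map_smul' r a := by ext i; simp

@[simp]
theorem piMap_apply (E : GradedRightFreeExtension 𝒜 ℬ) (a : ι → A) (i : ι) :
    E.piMap ι a i = E.π (a i) := rfl

theorem piMap_surjective (E : GradedRightFreeExtension 𝒜 ℬ) :
    Function.Surjective (E.piMap ι) := fun b =>
  ⟨fun i => Function.surjInv E.surjective (b i),
    funext fun i => Function.surjInv_eq E.surjective (b i)⟩

variable [Fintype ι]

theorem π_linearCombination (E : GradedRightFreeExtension 𝒜 ℬ) (x a : ι → A) :
    E.π (Fintype.linearCombination A x a) =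
      Fintype.linearCombination B (E.piMap ι x) (E.piMap ι a) := by
  simp [Fintype.linearCombination_apply]

theorem mem_I_mul_range (E : GradedRightFreeExtension 𝒜 ℬ) (x : ι → A) {y : A} :
    y ∈ E.I * LinearMap.range (Fintype.linearCombination A x) ↔
      ∃ a, E.piMap ι a = 0 ∧ Fintype.linearCombination A x a = y := by
  constructor
  · intro hy
    induction hy using Submodule.smul_induction_on' with
    | smul r hr n hn =>
      obtain ⟨c, rfl⟩ := hn
      refine ⟨r • c, ?_, map_smul _ _ _⟩
      ext i
      simp [E.mem_I.1 hr]
    | add y _ z _ hy hz =>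
      obtain ⟨a, ha, rfl⟩ := hy
      obtain ⟨b, hb, rfl⟩ := hz
      exact ⟨a + b, by rw [map_add, ha, hb, add_zero], map_add _ _ _⟩
  · rintro ⟨a, ha, rfl⟩
    rw [Fintype.linearCombination_apply]
    refine Submodule.sum_mem _ fun i _ => Ideal.mul_mem_mul (E.mem_I.2 (congrFun ha i)) ?_
    classical
    exact ⟨Pi.single i 1, by simp⟩

/-- Since `I` is right-free, the relations with coefficients in `I` lie in `I • S`, where `S` is
the module of all relations. -/
theorem mem_I_smul_ker (E : GradedRightFreeExtension 𝒜 ℬ) (x : ι → A) {a : ι → A}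
    (ha : Fintype.linearCombination A x a = 0) (hπ : E.piMap ι a = 0) :
    a ∈ E.I • LinearMap.ker (Fintype.linearCombination A x) := by
  classical
  have := E.free
  let u := Module.Free.chooseBasis Aᵐᵒᵖ (rightKer (E.π : A →+* B))
  let a' : ι → rightKer (E.π : A →+* B) := fun i => ⟨a i, congrFun hπ i⟩
  have hsum : ∑ i, MulOpposite.op (x i) • a' i = 0 := by
    apply Subtype.ext
    rw [Fintype.linearCombination_apply] at ha
    simpa [a'] using ha
  -- Writing `aᵢ = ∑ₗ uₗ cₗᵢ`, the relation becomes `∑ₗ uₗ (∑ᵢ cₗᵢ xᵢ) = 0`, so by freeness each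
  -- `cₗ` is itself a relation.
  let c : Module.Free.ChooseBasisIndex Aᵐᵒᵖ (rightKer (E.π : A →+* B)) → ι → A :=
    fun l i => (u.repr (a' i) l).unop
  have hc (l) : c l ∈ LinearMap.ker (Fintype.linearCombination A x) := by
    rw [LinearMap.mem_ker, Fintype.linearCombination_apply]
    have := congrArg (fun z => (u.repr z l).unop) hsum
    simpa [c, Finsupp.finsetSum_apply] using this
  let s := Finset.univ.biUnion fun i => (u.repr (a' i)).support
  have hau : a = ∑ l ∈ s, (u l : A) • c l := by
    ext i
    have hi : ∑ l ∈ s, u.repr (a' i) l • u l = a' i := by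
      conv_rhs => rw [← u.linearCombination_repr (a' i)]
      rw [Finsupp.linearCombination_apply]
      refine (Finsupp.sum_of_support_subset (u.repr (a' i)) ?_ (fun l c => c • u l)
        fun l _ => zero_smul Aᵐᵒᵖ (u l)).symm
      exact Finset.subset_biUnion_of_mem (fun i => (u.repr (a' i)).support) (Finset.mem_univ i)
    have := congrArg Subtype.val hi
    rw [AddSubmonoidClass.coe_finsetSum] at this
    rw [Finset.sum_apply]
    exact this.symm
  rw [hau]
  exact Submodule.sum_mem _ fun l _ => Submodule.smul_mem_smul (E.mem_I.2 (u l).2) (hc l)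

/-- A graded Nakayama lemma: a homogeneous submodule of the module of relations is everything as
soon as it has the same image over `B`. -/
theorem ker_le_of_piMap [IsConnectedGradedAlgebra 𝒜] [IsConnectedGradedAlgebra ℬ]
    (E : GradedRightFreeExtension 𝒜 ℬ) (d : ι → ℕ) (x : ι → A) {T : Submodule A (ι → A)}
    (hT : IsShiftedHomogeneous 𝒜 d T)
    (hTS : T ≤ LinearMap.ker (Fintype.linearCombination A x))
    (h : ∀ a ∈ LinearMap.ker (Fintype.linearCombination A x),
      ∃ t ∈ T, E.piMap ι t = E.piMap ι a) :
    LinearMap.ker (Fintype.linearCombination A x) ≤ T := by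
  suffices H : ∀ m, ∀ a ∈ LinearMap.ker (Fintype.linearCombination A x),
      shiftedProj 𝒜 d m a ∈ T from
    fun a ha => mem_of_forall_shiftedProj_mem 𝒜 d fun m => H m a ha
  intro m
  induction m using Nat.strong_induction_on with
  | _ m ih =>
  have hI : ∀ a ∈ E.I • LinearMap.ker (Fintype.linearCombination A x),
      shiftedProj 𝒜 d m a ∈ T := by
    intro a ha
    induction ha using Submodule.smul_induction_on' with
    | smul r hr n hn =>
      refine shiftedProj_smul_mem 𝒜 d fun e he => ?_
      -- Since `r ∈ I` has no component of degree `0`, only components of `n` of degree below `m`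
      -- contribute.
      rcases Nat.eq_zero_or_pos e with rfl | hpos
      · rw [E.decompose_zero_of_mem_I hr, zero_smul]
        exact T.zero_mem
      · exact T.smul_mem _ (ih (m - e) (by omega) n hn)
    | add a _ b _ ha hb => rw [map_add]; exact T.add_mem ha hb
  intro a ha
  obtain ⟨t, ht, hta⟩ := h a ha
  have hdiff := hI (a - t) (E.mem_I_smul_ker x
    (LinearMap.mem_ker.1 (Submodule.sub_mem _ ha (hTS ht))) (by rw [map_sub, hta, sub_self]))
  rw [← sub_add_cancel a t, map_add]
  exact T.add_mem hdiff (hT m t ht)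

/-- Lift finitely many generators of the image and take all homogeneous components of the lifts; by
Nakayama these generate all relations. -/
theorem fg_ker_iff_fg_map [IsConnectedGradedAlgebra 𝒜] [IsConnectedGradedAlgebra ℬ]
    (E : GradedRightFreeExtension 𝒜 ℬ) {d : ι → ℕ} {x : ι → A} (hx : ∀ i, x i ∈ 𝒜 (d i)) :
    (LinearMap.ker (Fintype.linearCombination A x)).FG ↔
      ((LinearMap.ker (Fintype.linearCombination A x)).map (E.piMap ι)).FG := by
  classical
  refine ⟨fun h => h.map _, ?_⟩
  rintro ⟨s, hs⟩
  have hsub : (s : Set (ι → B)) ⊆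
      E.piMap ι '' (LinearMap.ker (Fintype.linearCombination A x) : Set (ι → A)) := by
    rw [← Submodule.map_coe, ← hs]
    exact Submodule.subset_span
  obtain ⟨t, ht, rfl⟩ := Finset.subset_set_image_iff.1 hsub
  obtain ⟨T, hTS, hTfg, hT, htT⟩ :=
    (isShiftedHomogeneous_ker 𝒜 d hx).exists_fg_homogeneous 𝒜 d t.finite_toSet ht
  have hle : LinearMap.ker (Fintype.linearCombination A x) ≤ T := by
    refine E.ker_le_of_piMap d x hT hTS fun a ha => ?_
    have hmem : E.piMap ι a ∈ T.map (E.piMap ι) := by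
      have h1 : E.piMap ι a ∈ Submodule.span B ((t.image (E.piMap ι) : Finset _) : Set _) := by
        rw [hs]
        exact Submodule.mem_map_of_mem ha
      refine Submodule.span_le.2 ?_ h1
      rw [Finset.coe_image, Submodule.map_coe]
      exact Set.image_mono htT
    exact hmem
  rwa [le_antisymm hle hTS]

/-! ### `(I ∩ J)/(IJ)` as a quotient of the relations over `B` -/

theorem InterQuot.mk_eq_mk (E : GradedRightFreeExtension 𝒜 ℬ) {J : Ideal A}
    {y z : ↥(E.I ⊓ J)} : mk E J y = mk E J z ↔ (y : A) - z ∈ E.I * J :=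
  Submodule.Quotient.eq ((E.I * J).submoduleOf (E.I ⊓ J))

theorem InterQuot.mk_surjective (E : GradedRightFreeExtension 𝒜 ℬ) (J : Ideal A) :
    Function.Surjective (mk E J) :=
  Submodule.mkQ_surjective ((E.I * J).submoduleOf (E.I ⊓ J))

/-- With `J` generated by the `xᵢ`, the relations among the `π xᵢ` map onto `(I ∩ J) / (I J)`, and
the kernel of this map consists of the relations that lift to `A`. -/
theorem exists_relations_to_interQuot (E : GradedRightFreeExtension 𝒜 ℬ) (x : ι → A) :
    ∃ θ : LinearMap.ker (Fintype.linearCombination B (E.piMap ι x)) →ₗ[B]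
        E.InterQuot (LinearMap.range (Fintype.linearCombination A x)),
      Function.Surjective θ ∧ (LinearMap.ker θ).map (Submodule.subtype _) =
        (LinearMap.ker (Fintype.linearCombination A x)).map (E.piMap ι) := by
  let J : Ideal A := LinearMap.range (Fintype.linearCombination A x)
  let L := LinearMap.ker (Fintype.linearCombination B (E.piMap ι x))
  -- The lift is only set-theoretic; `hf` shows that the class modulo `IJ` does not depend on it,
  -- whence linearity of `θ`.
  let σ : (ι → B) → ι → A := Function.surjInv E.piMap_surjective
  have hσ (b : ι → B) : E.piMap ι (σ b) = b := Function.surjInv_eq E.piMap_surjective b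
  let f (a : ι → A) (ha : E.piMap ι a ∈ L) : ↥(E.I ⊓ J) :=
    ⟨Fintype.linearCombination A x a,
      E.mem_I.2 (by rw [E.π_linearCombination]; exact ha), ⟨a, rfl⟩⟩
  have hf {a b : ι → A} (ha : E.piMap ι a ∈ L) (hb : E.piMap ι b ∈ L)
      (h : E.piMap ι a = E.piMap ι b) :
      InterQuot.mk E J (f a ha) = InterQuot.mk E J (f b hb) := by
    rw [InterQuot.mk_eq_mk, E.mem_I_mul_range]
    exact ⟨a - b, by rw [map_sub, h, sub_self], map_sub _ _ _⟩
  have hL (b : L) : E.piMap ι (σ b) ∈ L := by rw [hσ]; exact b.2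
  let θ : L →ₗ[B] E.InterQuot J :=
    { toFun b := InterQuot.mk E J (f (σ b) (hL b))
      map_add' b c := by
        have hbc : E.piMap ι (σ b + σ c) ∈ L := by
          rw [map_add]; exact L.add_mem (hL b) (hL c)
        rw [← map_add, hf (hL (b + c)) hbc (by rw [map_add, hσ, hσ, hσ]; rfl)]
        exact congrArg _ (Subtype.ext (map_add _ _ _))
      map_smul' r b := by
        obtain ⟨r, rfl⟩ := E.surjective r
        have hrb : E.piMap ι (r • σ b) ∈ L := by
          rw [LinearMap.map_smulₛₗ]; exact L.smul_mem _ (hL b)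
        rw [RingHom.id_apply, InterQuot.smul_mk,
          hf (hL (E.π r • b)) hrb (by rw [LinearMap.map_smulₛₗ, hσ, hσ]; rfl)]
        exact congrArg _ (Subtype.ext (map_smul _ _ _)) }
  have hθ (a : ι → A) (ha : E.piMap ι a ∈ L) :
      θ ⟨E.piMap ι a, ha⟩ = InterQuot.mk E J (f a ha) := hf (hL ⟨_, ha⟩) ha (hσ _)
  refine ⟨θ, fun q => ?_, ?_⟩
  · obtain ⟨⟨y, hyI, a, rfl⟩, rfl⟩ := InterQuot.mk_surjective E J q
    exact ⟨⟨E.piMap ι a, by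
      rw [LinearMap.mem_ker, ← E.π_linearCombination]; exact hyI⟩, hθ a _⟩
  · ext b
    constructor
    · rintro ⟨⟨b, hb⟩, hker, rfl⟩
      obtain ⟨a, rfl⟩ := E.piMap_surjective b
      have h0 := (hθ a hb).symm.trans (LinearMap.mem_ker.1 hker)
      rw [← map_zero (InterQuot.mk E J), InterQuot.mk_eq_mk, E.mem_I_mul_range] at h0
      obtain ⟨c, hc, hca⟩ := h0
      -- `c` has coordinates in `I` and the same value as `a`, so `a - c` is a true relation with
      -- the same image over `B`.
      refine ⟨a - c, ?_, by rw [map_sub, hc, sub_zero]; rfl⟩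
      rw [SetLike.mem_coe, LinearMap.mem_ker, map_sub, hca]
      simp [f]
    · rintro ⟨a, ha, rfl⟩
      have haL : E.piMap ι a ∈ L := by
        rw [LinearMap.mem_ker, ← E.π_linearCombination, LinearMap.mem_ker.1 ha, map_zero]
      refine ⟨⟨_, haL⟩, ?_, rfl⟩
      rw [SetLike.mem_coe, LinearMap.mem_ker, hθ, ← map_zero (InterQuot.mk E J)]
      exact congrArg _ (Subtype.ext ha)

theorem fg_relations (hB : IsGradedLeftCoherent ℬ) {d : ι → ℕ} {y : ι → B}
    (hy : ∀ i, y i ∈ ℬ (d i)) : (LinearMap.ker (Fintype.linearCombination B y)).FG :=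
  (finitePresentation_range_iff y).1 <|
    hB _ (isHomogeneous_range ℬ d hy) (Submodule.fg_range _)

theorem finite_interQuot_range (hB : IsGradedLeftCoherent ℬ) (E : GradedRightFreeExtension 𝒜 ℬ)
    {d : ι → ℕ} {x : ι → A} (hx : ∀ i, x i ∈ 𝒜 (d i)) :
    Module.Finite B (E.InterQuot (LinearMap.range (Fintype.linearCombination A x))) := by
  have hL := fg_relations hB (y := E.piMap ι x) fun i => E.map_mem _ _ (hx i)
  have := Module.Finite.of_fg hL
  obtain ⟨θ, hθ, -⟩ := E.exists_relations_to_interQuot x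
  exact Module.Finite.of_surjective θ hθ

theorem finitePresentation_interQuot_range_iff [IsConnectedGradedAlgebra 𝒜]
    [IsConnectedGradedAlgebra ℬ] (hB : IsGradedLeftCoherent ℬ)
    (E : GradedRightFreeExtension 𝒜 ℬ) {d : ι → ℕ} {x : ι → A} (hx : ∀ i, x i ∈ 𝒜 (d i)) :
    Module.FinitePresentation B
        (E.InterQuot (LinearMap.range (Fintype.linearCombination A x))) ↔
      Module.FinitePresentation A (LinearMap.range (Fintype.linearCombination A x)) := by
  have hy : ∀ i, E.piMap ι x i ∈ ℬ (d i) := fun i => E.map_mem _ _ (hx i)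
  have := hB.finitePresentation ℬ d _ (isShiftedHomogeneous_ker ℬ d hy) (fg_relations hB hy)
  obtain ⟨θ, hθ, hker⟩ := E.exists_relations_to_interQuot x
  rw [← Module.FinitePresentation.fg_ker_iff θ hθ, finitePresentation_range_iff,
    E.fg_ker_iff_fg_map hx, ← hker]
  exact (Submodule.fg_map_iff _ (Submodule.injective_subtype _)).symm

end GradedRightFreeExtension

theorem theorem1p4 {k A B : Type*} [Field k] [Ring A] [Algebra k A] [Ring B] [Algebra k B]
    (𝒜 : ℕ → Submodule k A) [GradedAlgebra 𝒜] [IsConnectedGradedAlgebra 𝒜]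
    (ℬ : ℕ → Submodule k B) [GradedAlgebra ℬ] [IsConnectedGradedAlgebra ℬ]
    (hB : IsGradedLeftCoherent ℬ) (E : GradedRightFreeExtension 𝒜 ℬ) :
    (∀ J : Ideal A, J.IsHomogeneous 𝒜 → J.FG → Module.Finite B (E.InterQuot J)) ∧
    (IsGradedLeftCoherent 𝒜 ↔
      ∀ J : Ideal A, J.IsHomogeneous 𝒜 → J.FG →
        Module.FinitePresentation B (E.InterQuot J)) := by
  refine ⟨fun J hJ hfg => ?_, forall₃_congr fun J hJ hfg => ?_⟩
  all_goals obtain ⟨t, d, ht, rfl⟩ := hJ.exists_generators 𝒜 hfg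
  · exact E.finite_interQuot_range hB ht
  · exact (E.finitePresentation_interQuot_range_iff hB ht).symm
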